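/- Let $0<a\le b<\infty$ and let $c:[0,1]\to\mathbb{R}$ be measurable with $a\le c(x)\le b$ for all $x\in[0,1]$. Let $\mathsf{U}$ be the space of absolutely continuous $u:[0,1]\to\mathbb{C}$ with $u(0)=0$ and $u'\in L^2(0,1)$, with inner product $\langle u,v\rangle_{\mathsf U}=\int_0^1 u'(x)\overline{v'(x)}\,\mathrm{d}x$ and norm $\|u\|_{\mathsf U}=\langle u,u\rangle_{\mathsf U}^{1/2}$. Let $\mathsf{U}^*$ be the space of bounded antilinear functionals on $\mathsf{U}$; a distribution $f$ in the dual of $\mathsf U$ is identified with the functional $\mathcal{P}(\phi)=\int_0^1 f\,\overline{\phi}\,\mathrm{d}x$ (a duality pairing), and $f$ is called real-valued if $\mathcal{P}(\overline{\phi})=\overline{\mathcal{P}(\phi)}$ for all $\phi\in\mathsf{U}$. For $k\in\mathbb{R}$ let $$\mathcal{A}_{c,k}(u,v)=\int_0^1 u'\,\overline{v'}\,\mathrm{d}x-k^2\int_0^1 c(x)^{-2}u\,\overline{v}\,\mathrm{d}x-\mathrm{i}\,k\,c(1)^{-1}u(1)\overline{v(1)}.$$ This is the weak form of $-u''-(k/c)^2u=f$,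 $u(0)=0$, $u'(1)-\mathrm{i}(k/c(1))u(1)=0$. (1) (Well-posedness.) For every $k\in\mathbb{R}$, each of the problems $$\mathcal{A}_{c,k}(u,\phi)=\mathcal{P}(\phi)\ \ \forall\phi\in\mathsf{U}\qquad\text{and}\qquad \overline{\mathcal{A}_{c,k}(\phi,w)}=\mathcal{P}(\phi)\ \ \forall\phi\in\mathsf{U}$$ has exactly one solution in $\mathsf{U}$ for each $\mathcal{P}\in\mathsf{U}^*$, and its norm is at most $C\|\mathcal{P}\|_{\mathsf{U}^*}$ with $C$ independent of $\mathcal{P}$. Now let $\mathcal{P}_1,\dots,\mathcal{P}_n\in\mathsf{U}^*$ be real-valued sources, let $u_i(\cdot;k)$ and $w_i(\cdot;k)$ be the corresponding solutions of the first and the second (adjoint) problem, and put $d_{ij}(k)=\mathcal{P}_i(u_j(\cdot;k))$, $b_i(k)=u_i(1;k)$, $g_{ij}(k)=\langle w_i(\cdot;k),w_j(\cdot;k)\rangle_{\mathsf U}$. Then for all $k\in\mathbb{R}$ and all $i,j$: (2) $w_i(x;k)=\overline{u_i(x;k)}$ for all $x\in[0,1]$; (3) $d_{ij}(k)=d_{ji}(k)$;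 (4) $d_{ij}$ and $b_i$ are differentiable at $k$, and, with $'$ denoting the derivative with respect to $k$, $$g_{ij}(k)=\Re\Big(d_{ij}(k)+\tfrac{k}{2}d_{ij}'(k)\Big)+\frac{\mathrm{i}k^2}{2c(1)}\Big(\overline{b_i'(k)}\,b_j(k)-\overline{b_i(k)}\,b_j'(k)\Big).$$ -/

import Mathlib

open MeasureTheory Set
open scoped ComplexConjugate

namespace Helmholtz

/-- A function on `[0,1]`, viewed as a function on `ℝ` that is constant outside `[0,1]`. The
extension is only ever evaluated on `[0,1]` and differentiated in `(0,1)`, up to null sets. -/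
noncomputable def extend (u : unitInterval → ℂ) : ℝ → ℂ := IccExtend (zero_le_one' ℝ) u

theorem extend_add (u v : unitInterval → ℂ) : extend (u + v) = extend u + extend v := rfl

theorem extend_smul (r : ℂ) (u : unitInterval → ℂ) :
    extend (r • u) = fun x => r • extend u x := rfl

theorem extend_conj (u : unitInterval → ℂ) :
    extend (fun x => conj (u x)) = fun x => conj (extend u x) := rfl

theorem extend_coe (u : unitInterval → ℂ) (x : unitInterval) : extend u (x : ℝ) = u x :=
  IccExtend_val _ _ _

/-- The classical (almost everywhere) derivative `u'`; for absolutely continuous `u` it is the weak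
derivative. -/
noncomputable def derivative (u : unitInterval → ℂ) : ℝ → ℂ := deriv (extend u)

theorem ae_differentiableAt {u : unitInterval → ℂ}
    (hu : AbsolutelyContinuousOnInterval (extend u) 0 1) :
    ∀ᵐ x ∂(volume.restrict (Ioc (0 : ℝ) 1)), DifferentiableAt ℝ (extend u) x := by
  rw [ae_restrict_iff' measurableSet_Ioc]
  filter_upwards [hu.boundedVariationOn.ae_differentiableAt_of_mem_uIcc] with x hx hx'
  exact hx (by rw [uIcc_of_le zero_le_one]; exact Ioc_subset_Icc_self hx')

theorem derivative_add {u v : unitInterval → ℂ}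
    (hu : AbsolutelyContinuousOnInterval (extend u) 0 1)
    (hv : AbsolutelyContinuousOnInterval (extend v) 0 1) :
    derivative (u + v) =ᵐ[volume.restrict (Ioc (0 : ℝ) 1)] derivative u + derivative v := by
  filter_upwards [ae_differentiableAt hu, ae_differentiableAt hv] with x h1 h2
  exact deriv_add h1 h2

theorem derivative_smul (r : ℂ) (u : unitInterval → ℂ) :
    derivative (r • u) = r • derivative u := by
  funext x
  change deriv (fun y => r • extend u y) x = r • deriv (extend u) x
  exact deriv_fun_const_smul_field r (extend u)

theorem derivative_conj (u : unitInterval → ℂ) :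
    derivative (fun x => conj (u x)) = fun x => conj (derivative u x) := by
  funext x
  exact deriv.star (f := extend u) (x := x)

theorem absolutelyContinuous_conj {u : unitInterval → ℂ}
    (hu : AbsolutelyContinuousOnInterval (extend u) 0 1) :
    AbsolutelyContinuousOnInterval (extend fun x => conj (u x)) 0 1 := by
  have h : ∀ a b : ℂ, dist (conj a) (conj b) = dist a b := fun a b => by
    rw [dist_eq_norm, dist_eq_norm, ← map_sub, RCLike.norm_conj]
  simpa only [AbsolutelyContinuousOnInterval, extend_conj, h] using hu

/-- The functions `u : [0,1] → ℂ` with a square integrable derivative and `u(0) = 0`. -/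
def energySubmodule : Submodule ℂ (unitInterval → ℂ) where
  carrier := {u | AbsolutelyContinuousOnInterval (extend u) 0 1 ∧
    MemLp (derivative u) 2 (volume.restrict (Ioc (0 : ℝ) 1)) ∧ u 0 = 0}
  zero_mem' := by
    have h0 : extend 0 = fun _ => (0 : ℂ) := rfl
    refine ⟨?_, ?_, rfl⟩
    · simp [AbsolutelyContinuousOnInterval, h0, tendsto_const_nhds]
    · have : derivative 0 = 0 := by funext x; simp [derivative, h0]
      rw [this]
      exact MemLp.zero'
  add_mem' := by
    rintro u v ⟨hu, hu', hu0⟩ ⟨hv, hv', hv0⟩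
    refine ⟨?_, ?_, by simp [hu0, hv0]⟩
    · rw [extend_add]; exact hu.add hv
    · exact (hu'.add hv').ae_eq (derivative_add hu hv).symm
  smul_mem' := by
    rintro r u ⟨hu, hu', hu0⟩
    refine ⟨?_, ?_, by simp [hu0]⟩
    · rw [extend_smul]; exact hu.const_smul r
    · rw [derivative_smul]; exact hu'.const_smul r

/-- The Hilbert space `𝖴`; its norm is `‖u‖² = ∫₀¹ |u'|²` (see the instances below). -/
def USpace : Type := energySubmodule

namespace USpace

noncomputable instance instAddCommGroup : AddCommGroup USpace :=
  inferInstanceAs (AddCommGroup energySubmodule)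

noncomputable instance instModule : Module ℂ USpace :=
  inferInstanceAs (Module ℂ energySubmodule)

/-- The underlying function on `[0,1]`. -/
def toFun (u : USpace) : unitInterval → ℂ := u.1

instance instCoeFun : CoeFun USpace (fun _ => unitInterval → ℂ) := ⟨toFun⟩

theorem eq_of_apply {u v : USpace} (h : ∀ x, u x = v x) : u = v := Subtype.ext (funext h)

theorem toFun_add (u v : USpace) : (u + v).toFun = u.toFun + v.toFun := rfl

theorem toFun_smul (r : ℂ) (u : USpace) : (r • u).toFun = r • u.toFun := rfl

theorem absolutelyContinuous (u : USpace) : AbsolutelyContinuousOnInterval (extend u) 0 1 := u.2.1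

theorem memLp (u : USpace) : MemLp (derivative u) 2 (volume.restrict (Ioc (0 : ℝ) 1)) := u.2.2.1

theorem apply_zero (u : USpace) : u 0 = 0 := u.2.2.2

end USpace

/-- `⟨u, v⟩_𝖴 = ∫₀¹ u'(x) conj(v'(x)) dx`, linear in the first and antilinear in the second
argument. -/
noncomputable def innerU (u v : USpace) : ℂ :=
  ∫ x in (0 : ℝ)..1, derivative u x * conj (derivative v x)

namespace USpace

theorem integrable_mul_conj (u v : USpace) :
    Integrable (fun x => derivative u x * conj (derivative v x))
      (volume.restrict (Ioc (0 : ℝ) 1)) :=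
  u.memLp.integrable_mul v.memLp.star

theorem innerU_conj_symm (u v : USpace) : conj (innerU u v) = innerU v u := by
  rw [innerU, innerU, intervalIntegral.integral_of_le zero_le_one,
    intervalIntegral.integral_of_le zero_le_one, ← integral_conj]
  simp [mul_comm]

theorem innerU_self (u : USpace) :
    innerU u u = ((∫ x in Ioc (0 : ℝ) 1, ‖derivative u x‖ ^ 2 : ℝ) : ℂ) := by
  rw [innerU, intervalIntegral.integral_of_le zero_le_one, ← integral_complex_ofReal]
  simp [Complex.mul_conj, Complex.normSq_eq_norm_sq]

theorem innerU_add_right (u v w : USpace) : innerU u (v + w) = innerU u v + innerU u w := by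
  simp only [innerU, intervalIntegral.integral_of_le zero_le_one]
  rw [← integral_add (integrable_mul_conj u v) (integrable_mul_conj u w)]
  refine integral_congr_ae ?_
  filter_upwards [derivative_add v.absolutelyContinuous w.absolutelyContinuous] with x hx
  rw [toFun_add, hx, Pi.add_apply, map_add, mul_add]

theorem innerU_smul_right (u v : USpace) (r : ℂ) : innerU u (r • v) = conj r * innerU u v := by
  simp only [innerU, intervalIntegral.integral_of_le zero_le_one]
  rw [← integral_const_mul]
  refine integral_congr_ae (Filter.Eventually.of_forall fun x => ?_)
  simp only [toFun_smul, derivative_smul, Pi.smul_apply, smul_eq_mul, map_mul]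
  ring

theorem eq_zero_of_innerU_self {u : USpace} (h : innerU u u = 0) : u = 0 := by
  rw [innerU_self, Complex.ofReal_eq_zero, integral_eq_zero_iff_of_nonneg
    (fun x => by positivity) (u.memLp.integrable_norm_pow (by norm_num))] at h
  have hd : ∀ᵐ x : ℝ, x ∈ uIcc (0 : ℝ) 1 → HasDerivAt (extend u) 0 x := by
    have hne : ∀ᵐ x : ℝ, x ≠ 0 := by simp [ae_iff, measure_singleton]
    have h1 := (ae_restrict_iff' measurableSet_Ioc).1 h
    have h2 := (ae_restrict_iff' measurableSet_Ioc).1 (ae_differentiableAt u.absolutelyContinuous)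
    filter_upwards [hne, h1, h2] with x hx h1 h2 hx'
    rw [uIcc_of_le zero_le_one] at hx'
    have hx'' : x ∈ Ioc (0 : ℝ) 1 := ⟨lt_of_le_of_ne hx'.1 (Ne.symm hx), hx'.2⟩
    have h3 : deriv (extend u) x = 0 := by simpa [derivative] using h1 hx''
    rw [← h3]
    exact (h2 hx'').hasDerivAt
  obtain ⟨C, hC⟩ := u.absolutelyContinuous.const_of_ae_hasDerivAt_zero hd
  have key : ∀ y : unitInterval, u y = C := fun y => by
    rw [← extend_coe u.toFun y]
    exact hC y (by rw [uIcc_of_le zero_le_one]; exact y.2)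
  refine eq_of_apply fun y => ?_
  rw [key y, ← key 0, apply_zero]
  rfl

/-- Mathlib's inner product is antilinear in the first argument, so that `inner ℂ u v` is
`⟨v, u⟩_𝖴`. -/
@[reducible]
noncomputable def core : InnerProductSpace.Core ℂ USpace where
  inner u v := innerU v u
  conj_inner_symm u v := innerU_conj_symm u v
  re_inner_nonneg u := by
    change 0 ≤ (innerU u u).re
    rw [innerU_self, Complex.ofReal_re]
    exact integral_nonneg fun x => by positivity
  add_left u v w := innerU_add_right w u v
  smul_left u v r := innerU_smul_right v u r
  definite _ h := eq_zero_of_innerU_self h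

noncomputable instance instNormedAddCommGroup : NormedAddCommGroup USpace :=
  core.toNormedAddCommGroup

noncomputable instance instInnerProductSpace : InnerProductSpace ℂ USpace :=
  InnerProductSpace.ofCore core.toCore

theorem inner_eq (u v : USpace) : inner ℂ u v = innerU v u := rfl

/-- Pointwise complex conjugation on `𝖴`. -/
def conjU (u : USpace) : USpace :=
  ⟨fun x => conj (u x), absolutelyContinuous_conj u.absolutelyContinuous,
    by rw [derivative_conj]; exact u.memLp.star, by simp [u.apply_zero]⟩

end USpace

/-- The dual `H⁻¹` of `𝖴`: the bounded antilinear functionals `P`. The pairing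
`P(φ) = ∫₀¹ f(x) conj(φ(x)) dx` identifies a distribution `f` with the functional `P`. -/
abbrev Dual : Type := USpace →L⋆[ℂ] ℂ

/-- The distribution `f` represented by `P` is real-valued: `P(conj φ) = conj (P(φ))`. -/
def IsRealSource (P : Dual) : Prop := ∀ φ : USpace, P φ.conjU = conj (P φ)

/-- `𝒜_{c,k}(u,v) = ∫₀¹ u' conj(v') - k² ∫₀¹ c⁻² u conj(v) - i k c(1)⁻¹ u(1) conj(v(1))`. -/
noncomputable def form (c : ℝ → ℝ) (k : ℝ) (u v : USpace) : ℂ :=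
  (∫ x in (0 : ℝ)..1, derivative u x * conj (derivative v x))
    - (k : ℂ) ^ 2 * (∫ x in (0 : ℝ)..1, ((c x : ℂ) ^ 2)⁻¹ * extend u x * conj (extend v x))
    - Complex.I * (k : ℂ) * (c 1 : ℂ)⁻¹ * u 1 * conj (v 1)

/-- `u` is a weak solution of the Helmholtz equation with source `P`. -/
def IsWeakSolution (c : ℝ → ℝ) (k : ℝ) (P : Dual) (u : USpace) : Prop :=
  ∀ φ : USpace, form c k u φ = P φ

/-- `w` is a weak solution of the adjoint Helmholtz equation with source `P`. -/
def IsAdjointWeakSolution (c : ℝ → ℝ) (k : ℝ) (P : Dual) (w : USpace) : Prop :=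
  ∀ φ : USpace, conj (form c k φ w) = P φ

/-- A linear problem `S P u` (`u` solves the problem with data `P`) is well-posed: a solution
exists, is unique, and is bounded by the data. -/
def IsWellPosed (S : Dual → USpace → Prop) : Prop :=
  (∀ P : Dual, ∃! u : USpace, S P u) ∧ ∃ C : ℝ, ∀ (P : Dual) (u : USpace), S P u → ‖u‖ ≤ C * ‖P‖

end Helmholtz

/-! Differentiation identifies `USpace` isometrically with L²(0,1), so Riesz representation turns
each weak problem into T(k)u = p with T(z) = 1 - z²L - (iz/c(1))R, where L and R represent the mass
and boundary forms. Everything in (1) rests on the bound ‖u‖ ≤ C‖p‖ (`exists_norm_le_of_form_eq`).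
The imaginary part of the form at (u,u) is -(k/c(1))|u(1)|², so for k ≠ 0 the data control u(1).
With u(1) known, the equation is an initial value problem run backwards from x = 1, and Grönwall's
inequality bounds the whole solution; no smoothness of c is needed.

The form is complex symmetric: it is unchanged when its arguments are swapped and conjugated
(`form_conjU`). This makes T(k) have dense range once it is bounded below, hence be invertible. It
also reduces the adjoint problem to the direct one, which gives (2) for real sources, and it yields
the reciprocity (3).

For (4), T is polynomial in z, so u(k) = T(k)⁻¹p is differentiable, and u' solves the same problem
with source 2k·(mass form) + (i/c(1))·(boundary form). Testing with u_i the equations for u_j and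
u_j' lets one eliminate the unknown mass term. Averaging with the conjugate identity, indices
exchanged, cancels the boundary terms free of derivatives (`innerU_eq_of_solutions`). -/

namespace Helmholtz

/-! ### Complex-valued absolutely continuous functions -/

theorem absolutelyContinuousOnInterval_ofReal {f : ℝ → ℝ} {a b : ℝ}
    (hf : AbsolutelyContinuousOnInterval f a b) :
    AbsolutelyContinuousOnInterval (fun x => (f x : ℂ)) a b := by
  simpa only [AbsolutelyContinuousOnInterval, Complex.dist_eq, Real.dist_eq, ← Complex.ofReal_sub,
    Complex.norm_real, Real.norm_eq_abs] using hf

/-- Real and imaginary parts are treated separately by the real-valued result and recombined. -/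
theorem absolutelyContinuousOnInterval_primitive {f : ℝ → ℂ} {a b c : ℝ}
    (hf : IntervalIntegrable f volume a b) (hc : c ∈ uIcc a b) :
    AbsolutelyContinuousOnInterval (fun x => ∫ t in c..x, f t) a b := by
  have hre : IntervalIntegrable (fun t => (f t).re) volume a b :=
    ⟨hf.1.re, hf.2.re⟩
  have him : IntervalIntegrable (fun t => (f t).im) volume a b :=
    ⟨hf.1.im, hf.2.im⟩
  have h1 := absolutelyContinuousOnInterval_ofReal
    (hre.absolutelyContinuousOnInterval_intervalIntegral hc)
  have h2 := (absolutelyContinuousOnInterval_ofReal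
    (him.absolutelyContinuousOnInterval_intervalIntegral hc)).const_smul Complex.I
  have h3 := h1.add h2
  have hEq : ∀ x ∈ uIcc a b, (∫ t in c..x, f t) =
      ((∫ t in c..x, (f t).re : ℝ) : ℂ) + Complex.I • ((∫ t in c..x, (f t).im : ℝ) : ℂ) := by
    intro x hx
    have hcx : IntervalIntegrable f volume c x := hf.mono_set (uIcc_subset_uIcc hc hx)
    apply Complex.ext
    · have := Complex.reCLM.intervalIntegral_comp_comm hcx
      simp only [Complex.reCLM_apply] at this
      simp [this]
    · have := Complex.imCLM.intervalIntegral_comp_comm hcx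
      simp only [Complex.imCLM_apply] at this
      simp [this]
  -- Absolute continuity only samples values at endpoints of subintervals of [a,b], so equality on
  -- [a,b] is enough.
  refine Filter.Tendsto.congr' ?_ h3
  rw [Filter.EventuallyEq, Filter.eventually_inf_principal]
  refine Filter.Eventually.of_forall fun E hE => Finset.sum_congr rfl fun i hi => ?_
  simp only [Pi.add_apply, hEq _ (hE.1 i hi).1, hEq _ (hE.1 i hi).2]

/-- The fundamental theorem of calculus for complex valued absolutely continuous functions. -/
theorem integral_eq_sub_of_absolutelyContinuous {F f : ℝ → ℂ} {a b : ℝ}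
    (hF : AbsolutelyContinuousOnInterval F a b)
    (hd : ∀ᵐ x, x ∈ uIcc a b → HasDerivAt F (f x) x)
    (hf : IntervalIntegrable f volume a b) {x : ℝ} (hx : x ∈ uIcc a b) :
    ∫ t in a..x, f t = F x - F a := by
  -- F minus the primitive of f is absolutely continuous with derivative zero a.e., hence constant.
  have hG := hF.sub (absolutelyContinuousOnInterval_primitive hf left_mem_uIcc)
  obtain ⟨C, hC⟩ := hG.const_of_ae_hasDerivAt_zero (by
    filter_upwards [hd, hf.ae_hasDerivAt_integral] with x h1 h2 h3
    have := (h1 h3).sub (h2 h3 a left_mem_uIcc)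
    rwa [sub_self] at this)
  have h1 := hC a left_mem_uIcc
  have h2 := hC x hx
  simp only [Pi.sub_apply, intervalIntegral.integral_same, sub_zero] at h1 h2
  rw [h1, ← h2]
  ring

theorem extend_apply (u : unitInterval → ℂ) {x : ℝ} (hx : x ∈ Icc (0 : ℝ) 1) :
    extend u x = u ⟨x, hx⟩ :=
  extend_coe u ⟨x, hx⟩

theorem ae_mem_Ioo : ∀ᵐ x : ℝ, x ∈ Icc (0 : ℝ) 1 → x ∈ Ioo (0 : ℝ) 1 := by
  have h0 : ∀ᵐ x : ℝ, x ≠ 0 := by simp [ae_iff, measure_singleton]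
  have h1 : ∀ᵐ x : ℝ, x ≠ 1 := by simp [ae_iff, measure_singleton]
  filter_upwards [h0, h1] with x h0 h1 hx
  exact ⟨lt_of_le_of_ne hx.1 (Ne.symm h0), lt_of_le_of_ne hx.2 h1⟩

theorem hasDerivAt_extend_of_hasDerivAt {F : ℝ → ℂ} {F' : ℂ} {x : ℝ} (hx : x ∈ Ioo (0 : ℝ) 1)
    (h : HasDerivAt F F' x) : HasDerivAt (extend fun y => F y) F' x := by
  refine h.congr_of_eventuallyEq ?_
  filter_upwards [Icc_mem_nhds hx.1 hx.2] with y hy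
  exact extend_apply _ hy

theorem absolutelyContinuousOnInterval_extend {F : ℝ → ℂ}
    (h : AbsolutelyContinuousOnInterval F 0 1) :
    AbsolutelyContinuousOnInterval (extend fun y => F y) 0 1 := by
  refine Filter.Tendsto.congr' ?_ h
  rw [Filter.EventuallyEq, Filter.eventually_inf_principal]
  refine Filter.Eventually.of_forall fun E hE => Finset.sum_congr rfl fun i hi => ?_
  have h1 := (hE.1 i hi).1
  have h2 := (hE.1 i hi).2
  rw [uIcc_of_le zero_le_one] at h1 h2
  rw [extend_apply _ h1, extend_apply _ h2]

/-! ### The energy space: completeness and pointwise bounds -/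

namespace USpace

theorem ae_hasDerivAt (u : USpace) :
    ∀ᵐ x : ℝ, x ∈ uIcc (0 : ℝ) 1 → HasDerivAt (extend u) (derivative u x) x := by
  have h2 := (ae_restrict_iff' measurableSet_Ioc).1 (ae_differentiableAt u.absolutelyContinuous)
  filter_upwards [ae_mem_Ioo, h2] with x h1 h2 hx
  rw [uIcc_of_le zero_le_one] at hx
  exact (h2 (Ioo_subset_Ioc_self (h1 hx))).hasDerivAt

theorem intervalIntegrable_derivative (u : USpace) :
    IntervalIntegrable (derivative u) volume 0 1 := by
  rw [intervalIntegrable_iff_integrableOn_Ioc_of_le zero_le_one]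
  exact u.memLp.integrable one_le_two

theorem extend_zero (u : USpace) : extend u 0 = 0 := by
  rw [extend_apply _ (left_mem_Icc.2 zero_le_one)]
  exact u.apply_zero

theorem integral_derivative (u : USpace) {x : ℝ} (hx : x ∈ Icc (0 : ℝ) 1) :
    ∫ t in (0 : ℝ)..x, derivative u t = extend u x := by
  rw [← uIcc_of_le zero_le_one] at hx
  rw [integral_eq_sub_of_absolutelyContinuous u.absolutelyContinuous u.ae_hasDerivAt
    u.intervalIntegrable_derivative hx, extend_zero, sub_zero]

theorem ae_hasDerivAt_primitive {q : ℝ → ℂ} (hq : IntervalIntegrable q volume 0 1) :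
    ∀ᵐ x : ℝ, x ∈ Ioc (0 : ℝ) 1 →
      HasDerivAt (extend fun y => ∫ t in (0 : ℝ)..y, q t) (q x) x := by
  filter_upwards [ae_mem_Ioo, hq.ae_hasDerivAt_integral] with x h1 h2 hx
  have hx' := Ioc_subset_Icc_self hx
  refine hasDerivAt_extend_of_hasDerivAt (F := fun y => ∫ t in (0 : ℝ)..y, q t) (h1 hx') ?_
  exact h2 (by rwa [uIcc_of_le zero_le_one]) 0 left_mem_uIcc

theorem derivative_primitive_ae {q : ℝ → ℂ} (hq : IntervalIntegrable q volume 0 1) :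
    derivative (fun y => ∫ t in (0 : ℝ)..y, q t) =ᵐ[volume.restrict (Ioc (0 : ℝ) 1)] q := by
  rw [Filter.EventuallyEq, ae_restrict_iff' measurableSet_Ioc]
  filter_upwards [ae_hasDerivAt_primitive hq] with x h hx
  exact (h hx).deriv

/-- The antiderivative of a square integrable function that vanishes at `0`. -/
noncomputable def primitive (q : ℝ → ℂ) (hq : MemLp q 2 (volume.restrict (Ioc (0 : ℝ) 1))) :
    USpace :=
  have hi : IntervalIntegrable q volume 0 1 := by
    rw [intervalIntegrable_iff_integrableOn_Ioc_of_le zero_le_one]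
    exact hq.integrable one_le_two
  ⟨fun y => ∫ t in (0 : ℝ)..y, q t,
    absolutelyContinuousOnInterval_extend (F := fun y => ∫ t in (0 : ℝ)..y, q t)
      (absolutelyContinuousOnInterval_primitive hi left_mem_uIcc),
    hq.ae_eq (derivative_primitive_ae hi).symm, by
      change ∫ t in (0 : ℝ)..((0 : unitInterval) : ℝ), q t = 0
      rw [Icc.coe_zero, intervalIntegral.integral_same]⟩

theorem derivative_primitive (q : ℝ → ℂ) (hq : MemLp q 2 (volume.restrict (Ioc (0 : ℝ) 1))) :
    derivative (primitive q hq) =ᵐ[volume.restrict (Ioc (0 : ℝ) 1)] q :=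
  derivative_primitive_ae (by
    rw [intervalIntegrable_iff_integrableOn_Ioc_of_le zero_le_one]
    exact hq.integrable one_le_two)

/-- Differentiation, as a linear isometry onto `L²(0,1)`. -/
noncomputable def derivativeL2 :
    USpace →ₗᵢ[ℂ] Lp ℂ 2 (volume.restrict (Ioc (0 : ℝ) 1)) :=
  LinearMap.isometryOfInner
    { toFun := fun u => u.memLp.toLp (derivative u)
      map_add' := fun u v => by
        rw [← MemLp.toLp_add, MemLp.toLp_eq_toLp_iff]
        exact derivative_add u.absolutelyContinuous v.absolutelyContinuous
      map_smul' := fun r u => by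
        rw [RingHom.id_apply, ← MemLp.toLp_const_smul, MemLp.toLp_eq_toLp_iff]
        exact Filter.EventuallyEq.of_eq (derivative_smul r u) }
    (fun u v => by
      rw [L2.inner_def, inner_eq, innerU, intervalIntegral.integral_of_le zero_le_one]
      refine integral_congr_ae ?_
      filter_upwards [u.memLp.coeFn_toLp, v.memLp.coeFn_toLp] with x h1 h2
      simp only [LinearMap.coe_mk, AddHom.coe_mk, h1, h2, RCLike.inner_apply])

/-- By Lebesgue differentiation, an L² function is a.e. the derivative of its antiderivative.
Completeness of L² then transfers to `USpace`. -/
theorem derivativeL2_surjective : Function.Surjective derivativeL2 := fun f => by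
  refine ⟨primitive f (Lp.memLp f), ?_⟩
  refine Lp.ext ?_
  exact (primitive f (Lp.memLp f)).memLp.coeFn_toLp.trans (derivative_primitive f (Lp.memLp f))

instance instCompleteSpace : CompleteSpace USpace :=
  (LinearIsometryEquiv.ofSurjective derivativeL2
    derivativeL2_surjective).toIsometryEquiv.completeSpace

theorem norm_extend_le_integral (u : USpace) {x : ℝ} (hx : x ∈ Icc (0 : ℝ) 1) :
    ‖extend u x‖ ≤ ∫ t in (0 : ℝ)..1, ‖derivative u t‖ := by
  rw [← u.integral_derivative hx]
  refine (intervalIntegral.norm_integral_le_integral_norm hx.1).trans ?_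
  exact intervalIntegral.integral_mono_interval le_rfl hx.1 hx.2
    (Filter.Eventually.of_forall fun t => norm_nonneg _) u.intervalIntegrable_derivative.norm

theorem norm_sq_eq (u : USpace) :
    ‖u‖ ^ 2 = ∫ x in (0 : ℝ)..1, ‖derivative u x‖ ^ 2 := by
  have h := norm_sq_eq_re_inner (𝕜 := ℂ) u
  rw [h, inner_eq, innerU_self, intervalIntegral.integral_of_le zero_le_one]
  exact Complex.ofReal_re _

/-- Cauchy–Schwarz on a unit interval, in the form that the variance ∫(|u'| - I)² = ‖u‖² - I² is
nonnegative. -/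
theorem integral_norm_derivative_le (u : USpace) :
    ∫ t in (0 : ℝ)..1, ‖derivative u t‖ ≤ ‖u‖ := by
  set I := ∫ t in (0 : ℝ)..1, ‖derivative u t‖ with hI
  have h0 : 0 ≤ I := intervalIntegral.integral_nonneg zero_le_one fun t _ => norm_nonneg _
  have h2 : IntervalIntegrable (fun t => ‖derivative u t‖ ^ 2) volume 0 1 := by
    rw [intervalIntegrable_iff_integrableOn_Ioc_of_le zero_le_one]
    exact u.memLp.integrable_norm_pow (by norm_num)
  have h1 : IntervalIntegrable (fun t => ‖derivative u t‖) volume 0 1 :=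
    u.intervalIntegrable_derivative.norm
  have h3 : 0 ≤ ∫ t in (0 : ℝ)..1, (‖derivative u t‖ - I) ^ 2 :=
    intervalIntegral.integral_nonneg zero_le_one fun t _ => sq_nonneg _
  have h4 : (∫ t in (0 : ℝ)..1, (‖derivative u t‖ - I) ^ 2) = ‖u‖ ^ 2 - I ^ 2 := by
    have : ∀ t, (‖derivative u t‖ - I) ^ 2 =
        ‖derivative u t‖ ^ 2 - (2 * I) * ‖derivative u t‖ + I ^ 2 := fun t => by ring
    simp_rw [this]
    rw [intervalIntegral.integral_add (h2.sub (h1.const_mul _)) (by simp),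
      intervalIntegral.integral_sub h2 (h1.const_mul _), intervalIntegral.integral_const_mul,
      ← norm_sq_eq, ← hI]
    simp
    ring
  exact abs_le_of_sq_le_sq' (by linarith) (norm_nonneg u) |>.2

theorem norm_extend_le (u : USpace) {x : ℝ} (hx : x ∈ Icc (0 : ℝ) 1) : ‖extend u x‖ ≤ ‖u‖ :=
  (u.norm_extend_le_integral hx).trans u.integral_norm_derivative_le

theorem norm_apply_le (u : USpace) (x : unitInterval) : ‖u x‖ ≤ ‖u‖ := by
  rw [← extend_coe u.toFun x]
  exact u.norm_extend_le x.2

theorem continuousOn_extend (u : USpace) : ContinuousOn (extend u) (Icc 0 1) := by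
  have := u.absolutelyContinuous.continuousOn
  rwa [uIcc_of_le zero_le_one] at this

end USpace

/-! ### Grönwall's inequality -/

/-- Grönwall's inequality on `[0,1]`, backwards from the right end point. -/
theorem le_mul_exp_of_le_add_integral {F : ℝ → ℝ} {C D : ℝ} (hF : ContinuousOn F (Icc 0 1))
    (hC : 0 ≤ C) (hD : 0 ≤ D)
    (h : ∀ x ∈ Icc (0 : ℝ) 1, F x ≤ D + C * ∫ t in x..1, F t) :
    ∀ x ∈ Icc (0 : ℝ) 1, F x ≤ D * Real.exp C := by
  have hFi : IntervalIntegrable F volume 0 1 := by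
    refine ContinuousOn.intervalIntegrable ?_
    rwa [uIcc_of_le zero_le_one]
  -- Integrating factor: the hypothesis says exactly that G' ≥ 0, and G(1) = D·exp C.
  set G : ℝ → ℝ := fun x => (D + C * ∫ t in x..1, F t) * Real.exp (C * x) with hG
  have hcont : ContinuousOn (fun x => ∫ t in x..1, F t) (Icc 0 1) := by
    have h1 : ContinuousOn (fun x => ∫ t in (1 : ℝ)..x, F t) (uIcc 0 1) :=
      intervalIntegral.continuousOn_primitive_interval' hFi right_mem_uIcc
    rw [uIcc_of_le zero_le_one] at h1
    refine h1.neg.congr fun x _ => ?_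
    exact intervalIntegral.integral_symm _ _
  have hGc : ContinuousOn G (Icc 0 1) :=
    (continuousOn_const.add (continuousOn_const.mul hcont)).mul (by fun_prop)
  have hGd : ∀ x ∈ Ioo (0 : ℝ) 1, HasDerivAt G
      (C * (-F x) * Real.exp (C * x) +
        (D + C * ∫ t in x..1, F t) * (Real.exp (C * x) * C)) x := by
    intro x hx
    have hFx : IntervalIntegrable F volume x 1 := hFi.mono_set
      (uIcc_subset_uIcc (by rw [uIcc_of_le zero_le_one]; exact Ioo_subset_Icc_self hx)
        right_mem_uIcc)
    have h1 : HasDerivAt (fun x => ∫ t in x..1, F t) (-F x) x :=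
      intervalIntegral.integral_hasDerivAt_left hFx
        ((hF.mono Ioo_subset_Icc_self).stronglyMeasurableAtFilter isOpen_Ioo x hx)
        (hF.continuousAt (Icc_mem_nhds hx.1 hx.2))
    have h2 : HasDerivAt (fun x => Real.exp (C * x)) (Real.exp (C * x) * C) x := by
      simpa using ((hasDerivAt_id x).const_mul C).exp
    exact ((h1.const_mul C).const_add D).mul h2
  have hmono : MonotoneOn G (Icc 0 1) := by
    refine monotoneOn_of_deriv_nonneg (convex_Icc 0 1) hGc ?_ ?_
    · rw [interior_Icc]
      exact fun x hx => (hGd x hx).differentiableAt.differentiableWithinAt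
    · rw [interior_Icc]
      intro x hx
      rw [(hGd x hx).deriv]
      have := h x (Ioo_subset_Icc_self hx)
      have : C * (-F x) * Real.exp (C * x) +
          (D + C * ∫ t in x..1, F t) * (Real.exp (C * x) * C) =
          C * Real.exp (C * x) * ((D + C * ∫ t in x..1, F t) - F x) := by ring
      rw [this]
      have := Real.exp_pos (C * x)
      exact mul_nonneg (by positivity) (by linarith)
  intro x hx
  have h1 := hmono hx (right_mem_Icc.2 zero_le_one) hx.2
  simp only [hG, intervalIntegral.integral_same, mul_zero, add_zero, mul_one] at h1
  -- F may be negative, so the bracket need not be nonnegative; if it is negative then F x < 0 and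
  -- the bound is trivial.
  by_cases hs : 0 ≤ D + C * ∫ t in x..1, F t
  · have h2 : 1 ≤ Real.exp (C * x) := Real.one_le_exp (mul_nonneg hC hx.1)
    calc F x ≤ D + C * ∫ t in x..1, F t := h x hx
      _ ≤ (D + C * ∫ t in x..1, F t) * Real.exp (C * x) := le_mul_of_one_le_right hs h2
      _ ≤ _ := h1
  · have := h x hx
    have : 0 ≤ D * Real.exp C := by positivity
    linarith

/-! ### Fluxes and integration by parts -/

/-- The function `q(s) = z + ∫ₛ¹ h`, the flux `w'` of the solution `w` of `-w'' = h`, `w(0) = 0`,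
`w'(1) = z`. -/
noncomputable def flux (h : ℝ → ℂ) (z : ℂ) : ℝ → ℂ := fun s => z - ∫ t in (1 : ℝ)..s, h t

theorem absolutelyContinuousOnInterval_flux {h : ℝ → ℂ} (hh : IntervalIntegrable h volume 0 1)
    (z : ℂ) : AbsolutelyContinuousOnInterval (flux h z) 0 1 := by
  have h1 := absolutelyContinuousOnInterval_primitive hh right_mem_uIcc
  simpa only [AbsolutelyContinuousOnInterval, flux, dist_sub_left] using h1

theorem continuousOn_flux {h : ℝ → ℂ} (hh : IntervalIntegrable h volume 0 1) (z : ℂ) :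
    ContinuousOn (flux h z) (Icc 0 1) := by
  have := (absolutelyContinuousOnInterval_flux hh z).continuousOn
  rwa [uIcc_of_le zero_le_one] at this

theorem memLp_flux {h : ℝ → ℂ} (hh : IntervalIntegrable h volume 0 1) (z : ℂ) :
    MemLp (flux h z) 2 (volume.restrict (Ioc (0 : ℝ) 1)) := by
  obtain ⟨C, hC⟩ := (absolutelyContinuousOnInterval_flux hh z).exists_bound
  refine MemLp.of_bound (((continuousOn_flux hh z).mono
    Ioc_subset_Icc_self).aestronglyMeasurable measurableSet_Ioc) C ?_
  rw [ae_restrict_iff' measurableSet_Ioc]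
  refine Filter.Eventually.of_forall fun x hx => hC x ?_
  rw [uIcc_of_le zero_le_one]
  exact Ioc_subset_Icc_self hx

namespace USpace

/-- Integration by parts: apply the fundamental theorem to the absolutely continuous product of the
flux with conj φ. This supplies explicit representers of both the mass and the boundary form. -/
theorem innerU_primitive_flux {h : ℝ → ℂ} (hh : IntervalIntegrable h volume 0 1) (z : ℂ)
    (φ : USpace) :
    innerU (primitive (flux h z) (memLp_flux hh z)) φ =
      (∫ x in (0 : ℝ)..1, h x * conj (extend φ x)) + z * conj (φ 1) := by
  have hφ : ContinuousOn (fun x => conj (extend φ x)) (uIcc 0 1) := by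
    rw [uIcc_of_le zero_le_one]
    exact Complex.continuous_conj.comp_continuousOn φ.continuousOn_extend
  have hq : ContinuousOn (flux h z) (uIcc 0 1) := by
    rw [uIcc_of_le zero_le_one]
    exact continuousOn_flux hh z
  have hφ' : IntervalIntegrable (fun x => conj (derivative φ x)) volume 0 1 := by
    rw [← derivative_conj]
    exact φ.conjU.intervalIntegrable_derivative
  have i1 : IntervalIntegrable (fun x => h x * conj (extend φ x)) volume 0 1 :=
    hh.mul_continuousOn hφ
  have i2 : IntervalIntegrable (fun x => flux h z x * conj (derivative φ x)) volume 0 1 :=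
    hφ'.continuousOn_mul hq
  have hAC := (absolutelyContinuousOnInterval_flux hh z).smul
    (absolutelyContinuous_conj φ.absolutelyContinuous)
  have hd : ∀ᵐ x, x ∈ uIcc (0 : ℝ) 1 →
      HasDerivAt (flux h z • extend fun x => conj (φ x))
        (flux h z x * conj (derivative φ x) - h x * conj (extend φ x)) x := by
    filter_upwards [φ.ae_hasDerivAt, hh.ae_hasDerivAt_integral] with x h1 h2 hx
    have h3 : HasDerivAt (flux h z) (-h x) x := (h2 hx 1 right_mem_uIcc).const_sub z
    have h4 := h3.mul (h1 hx).star
    refine h4.congr_deriv ?_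
    simp only [RCLike.star_def]
    ring
  have key := integral_eq_sub_of_absolutelyContinuous hAC hd (i2.sub i1) right_mem_uIcc
  rw [intervalIntegral.integral_sub i2 i1] at key
  have e1 : (flux h z • extend fun x => conj (φ x)) 1 = z * conj (φ 1) := by
    rw [Pi.smul_apply', extend_apply _ (right_mem_Icc.2 zero_le_one)]
    simp [flux]
  have e0 : (flux h z • extend fun x => conj (φ x)) 0 = 0 := by
    rw [Pi.smul_apply', extend_conj]
    simp [φ.extend_zero]
  have e2 : innerU (primitive (flux h z) (memLp_flux hh z)) φ =
      ∫ x in (0 : ℝ)..1, flux h z x * conj (derivative φ x) := by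
    rw [innerU, intervalIntegral.integral_of_le zero_le_one,
      intervalIntegral.integral_of_le zero_le_one]
    refine integral_congr_ae ?_
    filter_upwards [derivative_primitive (flux h z) (memLp_flux hh z)] with x hx
    rw [hx]
  rw [e1, e0] at key
  rw [e2]
  linear_combination key

/-! ### Representing forms and functionals -/

theorem innerU_add_left (u v w : USpace) : innerU (u + v) w = innerU u w + innerU v w :=
  inner_add_right (𝕜 := ℂ) w u v

theorem innerU_sub_left (u v w : USpace) : innerU (u - v) w = innerU u w - innerU v w :=
  inner_sub_right (𝕜 := ℂ) w u v

theorem innerU_smul_left (r : ℂ) (u v : USpace) : innerU (r • u) v = r * innerU u v :=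
  inner_smul_right (𝕜 := ℂ) v u r

theorem norm_innerU_le (u v : USpace) : ‖innerU u v‖ ≤ ‖u‖ * ‖v‖ :=
  (norm_inner_le_norm (𝕜 := ℂ) v u).trans_eq (mul_comm _ _)

theorem innerU_self_eq (u : USpace) : innerU u u = ((‖u‖ ^ 2 : ℝ) : ℂ) := by
  have := inner_self_eq_norm_sq_to_K (𝕜 := ℂ) u
  rw [inner_eq] at this
  simpa using this

theorem eq_of_innerU {u v : USpace} (h : ∀ φ, innerU u φ = innerU v φ) : u = v :=
  ext_inner_left ℂ fun φ => h φ

/-- A bounded sesquilinear form whose values at each first argument are represented by an element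
of `𝖴` comes from a bounded operator. -/
theorem exists_operator {B : USpace → USpace → ℂ} {M : ℝ} (hM : 0 ≤ M)
    (hadd : ∀ u v φ, B (u + v) φ = B u φ + B v φ) (hsmul : ∀ (r : ℂ) u φ, B (r • u) φ = r * B u φ)
    (hB : ∀ u φ, ‖B u φ‖ ≤ M * ‖u‖ * ‖φ‖) (hrep : ∀ u, ∃ w, ∀ φ, innerU w φ = B u φ) :
    ∃ L : USpace →L[ℂ] USpace, ∀ u φ, innerU (L u) φ = B u φ := by
  choose f hf using hrep
  refine ⟨LinearMap.mkContinuous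
    { toFun := f
      map_add' := fun u v => eq_of_innerU fun φ => by
        rw [innerU_add_left, hf, hf, hf, hadd]
      map_smul' := fun r u => eq_of_innerU fun φ => by
        rw [RingHom.id_apply, innerU_smul_left, hf, hf, hsmul] } M fun u => ?_, hf⟩
  change ‖f u‖ ≤ M * ‖u‖
  -- Testing with the representer itself gives ‖f u‖² ≤ M‖u‖‖f u‖.
  have h1 := hB u (f u)
  rw [← hf, innerU_self_eq, Complex.norm_real, norm_pow, norm_norm] at h1
  by_cases h0 : ‖f u‖ = 0
  · rw [h0]; positivity
  · have : 0 < ‖f u‖ := lt_of_le_of_ne (norm_nonneg _) (Ne.symm h0)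
    exact le_of_mul_le_mul_right (by nlinarith) this

theorem exists_riesz (P : Dual) : ∃ p : USpace, (∀ φ, innerU p φ = P φ) ∧ ‖p‖ ≤ ‖P‖ := by
  let f : StrongDual ℂ USpace := LinearMap.mkContinuous
    { toFun := fun φ => conj (P φ)
      map_add' := fun u v => by simp
      map_smul' := fun r u => by simp } ‖P‖ (fun u => by
        simpa using P.le_opNorm u)
  refine ⟨(InnerProductSpace.toDual ℂ USpace).symm f, fun φ => ?_, ?_⟩
  · have h : inner ℂ ((InnerProductSpace.toDual ℂ USpace).symm f) φ = conj (P φ) :=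
      InnerProductSpace.toDual_symm_apply
    rw [inner_eq] at h
    rw [← innerU_conj_symm, h, Complex.conj_conj]
  · rw [LinearIsometryEquiv.norm_map]
    exact LinearMap.mkContinuous_norm_le _ (norm_nonneg P) _

end USpace

/-! ### The Helmholtz form and its conjugation symmetry -/

open USpace

/-- The weight `c⁻²` as a complex valued function. -/
noncomputable def slowness (c : ℝ → ℝ) (x : ℝ) : ℂ := ((c x : ℂ) ^ 2)⁻¹

/-- The weighted `L²` form `∫₀¹ c⁻² u conj(v)`. -/
noncomputable def massForm (c : ℝ → ℝ) (u v : USpace) : ℂ :=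
  ∫ x in (0 : ℝ)..1, slowness c x * extend u x * conj (extend v x)

theorem form_eq (c : ℝ → ℝ) (k : ℝ) (u v : USpace) :
    form c k u v = innerU u v - (k : ℂ) ^ 2 * massForm c u v
      - Complex.I * (k : ℂ) * (c 1 : ℂ)⁻¹ * u 1 * conj (v 1) := rfl

namespace USpace

theorem conjU_conjU (u : USpace) : u.conjU.conjU = u :=
  eq_of_apply fun x => Complex.conj_conj (u x)

theorem conjU_apply (u : USpace) (x : unitInterval) : u.conjU x = conj (u x) := rfl

theorem extend_conjU (u : USpace) (x : ℝ) : extend u.conjU x = conj (extend u x) := rfl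

theorem derivative_conjU (u : USpace) (x : ℝ) :
    derivative u.conjU x = conj (derivative u x) := congrFun (derivative_conj u) x

theorem norm_conjU (u : USpace) : ‖u.conjU‖ = ‖u‖ := by
  have h : ‖u.conjU‖ ^ 2 = ‖u‖ ^ 2 := by
    rw [norm_sq_eq, norm_sq_eq]
    simp only [derivative_conjU, RCLike.norm_conj]
  exact (sq_eq_sq₀ (norm_nonneg _) (norm_nonneg _)).1 h

theorem conjU_add (u v : USpace) : (u + v).conjU = u.conjU + v.conjU :=
  eq_of_apply fun x => map_add (starRingEnd ℂ) (u x) (v x)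

theorem conjU_smul (r : ℂ) (u : USpace) : (r • u).conjU = conj r • u.conjU :=
  eq_of_apply fun x => map_mul (starRingEnd ℂ) r (u x)

end USpace

/-- All three terms are integrals or values of products with scalar coefficients, so (u,v) ↦ `form c
k u v.conjU` is a symmetric bilinear form. -/
theorem form_conjU (c : ℝ → ℝ) (k : ℝ) (u v : USpace) :
    form c k v.conjU u.conjU = form c k u v := by
  simp only [form, derivative_conjU, extend_conjU, conjU_apply, Complex.conj_conj]
  congr 1
  · congr 1
    · simp only [mul_comm]
    · congr 2
      funext x
      ring
  · ring

theorem form_conjU_right (c : ℝ → ℝ) (k : ℝ) (u v : USpace) :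
    form c k u v.conjU = form c k v u.conjU := by
  rw [← form_conjU, conjU_conjU]

/-! ### Mass and boundary operators, and stability -/

section

variable {c : ℝ → ℝ} {a : ℝ}

theorem norm_slowness_le (ha : 0 < a) (hc : ∀ x ∈ Icc (0 : ℝ) 1, a ≤ c x) {x : ℝ}
    (hx : x ∈ Icc (0 : ℝ) 1) : ‖slowness c x‖ ≤ (a ^ 2)⁻¹ := by
  have h1 := hc x hx
  rw [slowness, norm_inv, norm_pow, Complex.norm_real, Real.norm_of_nonneg (ha.le.trans h1)]
  gcongr

theorem intervalIntegrable_slowness (ha : 0 < a) (hc : ∀ x ∈ Icc (0 : ℝ) 1, a ≤ c x)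
    (hcm : AEMeasurable c (volume.restrict (Icc (0 : ℝ) 1))) :
    IntervalIntegrable (slowness c) volume 0 1 := by
  rw [intervalIntegrable_iff_integrableOn_Icc_of_le zero_le_one]
  have hm : AEMeasurable (slowness c) (volume.restrict (Icc (0 : ℝ) 1)) :=
    ((Complex.measurable_ofReal.comp_aemeasurable hcm).pow_const 2).inv
  refine Integrable.of_bound hm.aestronglyMeasurable (a ^ 2)⁻¹ ?_
  rw [ae_restrict_iff' measurableSet_Icc]
  exact Filter.Eventually.of_forall fun x hx => norm_slowness_le ha hc hx

theorem intervalIntegrable_slowness_mul (hs : IntervalIntegrable (slowness c) volume 0 1)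
    (u : USpace) : IntervalIntegrable (fun x => slowness c x * extend u x) volume 0 1 := by
  refine hs.mul_continuousOn ?_
  rw [uIcc_of_le zero_le_one]
  exact u.continuousOn_extend

theorem exists_massOperator (ha : 0 < a) (hc : ∀ x ∈ Icc (0 : ℝ) 1, a ≤ c x)
    (hs : IntervalIntegrable (slowness c) volume 0 1) :
    ∃ L : USpace →L[ℂ] USpace, ∀ u φ, innerU (L u) φ = massForm c u φ := by
  have hi : ∀ u φ : USpace, IntervalIntegrable
      (fun x => slowness c x * extend u x * conj (extend φ x)) volume 0 1 := fun u φ =>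
    (intervalIntegrable_slowness_mul hs u).mul_continuousOn (by
      rw [uIcc_of_le zero_le_one]
      exact φ.conjU.continuousOn_extend)
  refine exists_operator (M := (a ^ 2)⁻¹) (by positivity) (fun u v φ => ?_) (fun r u φ => ?_)
    (fun u φ => ?_) fun u => ?_
  · rw [massForm, massForm, massForm, ← intervalIntegral.integral_add (hi u φ) (hi v φ)]
    refine intervalIntegral.integral_congr fun x _ => ?_
    simp only [toFun_add, extend_add, Pi.add_apply]
    ring
  · rw [massForm, massForm, ← intervalIntegral.integral_const_mul]
    refine intervalIntegral.integral_congr fun x _ => ?_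
    simp only [toFun_smul, extend_smul, smul_eq_mul]
    ring
  · have := intervalIntegral.norm_integral_le_of_norm_le_const (a := (0 : ℝ)) (b := 1)
      (C := (a ^ 2)⁻¹ * ‖u‖ * ‖φ‖)
      (f := fun x => slowness c x * extend u x * conj (extend φ x)) (fun x hx => by
        rw [uIoc_of_le zero_le_one] at hx
        have hx' := Ioc_subset_Icc_self hx
        rw [norm_mul, norm_mul, RCLike.norm_conj]
        have h1 := norm_slowness_le ha hc hx'
        have h2 := u.norm_extend_le hx'
        have h3 := φ.norm_extend_le hx'
        gcongr)
    rw [sub_zero, abs_one, mul_one] at this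
    exact this
  -- The representer solves -w'' = c⁻²u, w(0) = 0, w'(1) = 0.
  · exact ⟨_, fun φ => by
      rw [innerU_primitive_flux (intervalIntegrable_slowness_mul hs u) 0 φ, zero_mul, add_zero]
      rfl⟩

theorem exists_boundaryOperator :
    ∃ R : USpace →L[ℂ] USpace, ∀ u φ, innerU (R u) φ = u 1 * conj (φ 1) := by
  refine exists_operator (M := 1) zero_le_one (fun u v φ => ?_) (fun r u φ => ?_)
    (fun u φ => ?_) fun u => ?_
  · simp only [toFun_add, Pi.add_apply]
    ring
  · simp only [toFun_smul, Pi.smul_apply, smul_eq_mul]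
    ring
  · rw [norm_mul, RCLike.norm_conj, one_mul]
    exact mul_le_mul (u.norm_apply_le 1) (φ.norm_apply_le 1) (norm_nonneg _) (norm_nonneg _)
  -- With h = 0 the flux is the constant u(1), so the representer is x ↦ x·u(1).
  · have h0 : IntervalIntegrable (fun _ => (0 : ℂ)) volume 0 1 := by simp
    exact ⟨_, fun φ => by rw [innerU_primitive_flux h0 (u 1) φ]; simp⟩

/-- The Hilbert space norm of a weak solution is controlled by its data and its value at `1`. -/
theorem exists_norm_le_add_norm_apply_one (ha : 0 < a) (hc : ∀ x ∈ Icc (0 : ℝ) 1, a ≤ c x)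
    (hs : IntervalIntegrable (slowness c) volume 0 1) (k : ℝ) :
    ∃ A : ℝ, 0 ≤ A ∧ ∀ u p : USpace, (∀ φ, form c k u φ = innerU p φ) →
      ‖u‖ ≤ A * (‖u 1‖ + ‖p‖) := by
  set κ : ℝ := k ^ 2 * (a ^ 2)⁻¹ with hκ
  set ζ : ℂ := Complex.I * (k : ℂ) * (c 1 : ℂ)⁻¹ with hζ
  have hκ0 : 0 ≤ κ := by positivity
  refine ⟨1 + (1 + ‖ζ‖ + κ) * Real.exp (1 + κ), by positivity, fun u p hu => ?_⟩
  set h : ℝ → ℂ := fun x => (k : ℂ) ^ 2 * (slowness c x * extend u x) with hh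
  have hi : IntervalIntegrable h volume 0 1 :=
    (intervalIntegrable_slowness_mul hs u).const_mul _
  set q := flux h (ζ * u 1) with hq
  set w : USpace := primitive q (memLp_flux hi (ζ * u 1)) with hw
  -- The derivative of u is only L². Splitting off p leaves w, whose derivative agrees a.e. with the
  -- continuous flux q, so pointwise estimates become available.
  have hup : u = p + w := eq_of_innerU fun φ => by
    rw [innerU_add_left, hw, innerU_primitive_flux hi, ← hu, form_eq, hh, massForm, hζ]
    simp_rw [mul_assoc]
    rw [intervalIntegral.integral_const_mul]
    ring
  have hqc : ContinuousOn q (Icc 0 1) := continuousOn_flux hi _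
  have hqi : IntervalIntegrable q volume 0 1 := by
    refine ContinuousOn.intervalIntegrable ?_
    rwa [uIcc_of_le zero_le_one]
  have hW : ∀ x ∈ Icc (0 : ℝ) 1, extend w x = ∫ t in (0 : ℝ)..x, q t := fun x hx =>
    extend_apply _ hx
  have hsub : ∀ x ∈ Icc (0 : ℝ) 1, uIcc x 1 ⊆ uIcc (0 : ℝ) 1 := fun x hx =>
    uIcc_subset_uIcc (by rwa [uIcc_of_le zero_le_one]) right_mem_uIcc
  have hu1 : ‖w 1‖ ≤ ‖u 1‖ + ‖p‖ := by
    have h1 : w 1 = u 1 - p 1 := by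
      rw [hup, toFun_add, Pi.add_apply, add_sub_cancel_left]
    rw [h1]
    exact (norm_sub_le _ _).trans (by gcongr; exact p.norm_apply_le 1)
  -- Size of the state (w, w') of the first-order system, to which Grönwall is applied from x = 1.
  set F : ℝ → ℝ := fun x => ‖extend w x‖ + ‖q x‖ with hF
  have hFc : ContinuousOn F (Icc 0 1) := w.continuousOn_extend.norm.add hqc.norm
  have hFi : IntervalIntegrable F volume 0 1 := by
    refine ContinuousOn.intervalIntegrable ?_
    rwa [uIcc_of_le zero_le_one]
  have hwbound : ∀ x ∈ Icc (0 : ℝ) 1, ‖extend w x‖ ≤ ‖u 1‖ + ‖p‖ + ∫ t in x..1, F t := by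
    intro x hx
    have h1 : extend w x = w 1 - ∫ t in x..1, q t := by
      have h2 := hW 1 (right_mem_Icc.2 zero_le_one)
      rw [extend_apply _ (right_mem_Icc.2 zero_le_one)] at h2
      change w 1 = _ at h2
      rw [h2, hW x hx, eq_sub_iff_add_eq]
      refine intervalIntegral.integral_add_adjacent_intervals (hqi.mono_set ?_)
        (hqi.mono_set (hsub x hx))
      exact uIcc_subset_uIcc left_mem_uIcc (by rwa [uIcc_of_le zero_le_one])
    rw [h1]
    refine (norm_sub_le _ _).trans (add_le_add hu1 ?_)
    refine intervalIntegral.norm_integral_le_of_norm_le hx.2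
      (Filter.Eventually.of_forall fun t _ => ?_) (hFi.mono_set (hsub x hx))
    simp [hF]
  have hqbound : ∀ x ∈ Icc (0 : ℝ) 1,
      ‖q x‖ ≤ ‖ζ‖ * ‖u 1‖ + κ * (‖p‖ + ∫ t in x..1, F t) := by
    intro x hx
    have h1 : q x = ζ * u 1 + ∫ t in x..1, h t := by
      rw [hq, flux, intervalIntegral.integral_symm, sub_neg_eq_add]
    rw [h1]
    refine (norm_add_le _ _).trans (add_le_add (norm_mul _ _).le ?_)
    have h2 : ‖∫ t in x..1, h t‖ ≤ ∫ t in x..1, κ * (‖p‖ + F t) := by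
      refine intervalIntegral.norm_integral_le_of_norm_le hx.2
        (Filter.Eventually.of_forall fun t ht => ?_)
        ((intervalIntegrable_const.add (hFi.mono_set (hsub x hx))).const_mul _)
      have ht' : t ∈ Icc (0 : ℝ) 1 := ⟨hx.1.trans ht.1.le, ht.2⟩
      have h3 : extend u t = extend p t + extend w t := by rw [hup]; rfl
      have h4 := p.norm_extend_le ht'
      have h5 := norm_slowness_le ha hc ht'
      have h6 : ‖extend u t‖ ≤ ‖p‖ + F t := by
        rw [h3]
        refine (norm_add_le _ _).trans (add_le_add h4 ?_)
        simp [hF]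
      rw [hh, norm_mul, norm_pow, Complex.norm_real, Real.norm_eq_abs, sq_abs, norm_mul, hκ,
        mul_assoc]
      gcongr
    refine h2.trans ?_
    rw [intervalIntegral.integral_const_mul, intervalIntegral.integral_add
      intervalIntegrable_const (hFi.mono_set (hsub x hx)), intervalIntegral.integral_const,
      smul_eq_mul]
    have : (1 - x) * ‖p‖ ≤ ‖p‖ := by nlinarith [hx.1, norm_nonneg p]
    gcongr
  have hmain := le_mul_exp_of_le_add_integral (C := 1 + κ)
    (D := (1 + ‖ζ‖ + κ) * (‖u 1‖ + ‖p‖)) hFc (by positivity) (by positivity) (fun x hx => by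
      have h1 := hwbound x hx
      have h2 := hqbound x hx
      have h3 : 0 ≤ ‖ζ‖ * ‖p‖ := by positivity
      have h4 : 0 ≤ κ * ‖u 1‖ := by positivity
      change ‖extend w x‖ + ‖q x‖ ≤ _
      nlinarith)
  set D := (1 + ‖ζ‖ + κ) * (‖u 1‖ + ‖p‖) * Real.exp (1 + κ) with hD
  have hD0 : 0 ≤ D := by positivity
  have hwn : ‖w‖ ≤ D := by
    have h1 : ‖w‖ ^ 2 ≤ D ^ 2 := by
      rw [norm_sq_eq]
      have h2 : (∫ x in (0 : ℝ)..1, ‖derivative w x‖ ^ 2) = ∫ x in (0 : ℝ)..1, ‖q x‖ ^ 2 := by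
        rw [intervalIntegral.integral_of_le zero_le_one,
          intervalIntegral.integral_of_le zero_le_one]
        refine integral_congr_ae ?_
        filter_upwards [derivative_primitive q (memLp_flux hi (ζ * u 1))] with x hx
        rw [hx]
      rw [h2]
      have h3 : IntervalIntegrable (fun x => ‖q x‖ ^ 2) volume 0 1 := by
        refine ContinuousOn.intervalIntegrable ?_
        rw [uIcc_of_le zero_le_one]
        exact hqc.norm.pow 2
      have h4 := intervalIntegral.integral_mono_on zero_le_one h3
        (intervalIntegrable_const (c := D ^ 2)) (fun x hx => by
          have h5 := hmain x hx
          have h6 : ‖q x‖ ≤ F x := by simp [hF]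
          have h7 := h6.trans h5
          gcongr)
      simpa using h4
    exact abs_le_of_sq_le_sq' h1 hD0 |>.2
  calc ‖u‖ ≤ ‖p‖ + ‖w‖ := by rw [hup]; exact norm_add_le _ _
    _ ≤ (‖u 1‖ + ‖p‖) + D := add_le_add (le_add_of_nonneg_left (norm_nonneg _)) hwn
    _ = _ := by rw [hD]; ring

theorem massForm_self_im (c : ℝ → ℝ) (u : USpace) : (massForm c u u).im = 0 := by
  have h : massForm c u u =
      ((∫ x in (0 : ℝ)..1, ((c x) ^ 2)⁻¹ * ‖extend u x‖ ^ 2 : ℝ) : ℂ) := by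
    rw [massForm, ← intervalIntegral.integral_ofReal]
    refine intervalIntegral.integral_congr fun x _ => ?_
    simp only [slowness]
    rw [mul_assoc, Complex.mul_conj, Complex.normSq_eq_norm_sq]
    push_cast
    rfl
  rw [h, Complex.ofReal_im]

theorem massForm_conj_symm (c : ℝ → ℝ) (u v : USpace) :
    conj (massForm c u v) = massForm c v u := by
  rw [massForm, massForm, intervalIntegral.integral_of_le zero_le_one,
    intervalIntegral.integral_of_le zero_le_one, ← integral_conj]
  congr 1
  funext x
  simp only [slowness, map_mul, map_inv₀, map_pow, Complex.conj_ofReal, Complex.conj_conj]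
  ring

/-- The energy and mass terms are Hermitian, while the boundary term is skew; the correction is
twice the latter. -/
theorem form_conj_symm (c : ℝ → ℝ) (k : ℝ) (u v : USpace) :
    conj (form c k u v) =
      form c k v u + 2 * Complex.I * (k : ℂ) * (c 1 : ℂ)⁻¹ * v 1 * conj (u 1) := by
  rw [form_eq, form_eq, map_sub, map_sub, innerU_conj_symm, map_mul, massForm_conj_symm]
  simp only [map_mul, map_inv₀, map_pow, Complex.conj_ofReal, Complex.conj_conj, Complex.conj_I]
  ring

/-- Stability of the Helmholtz problem. -/
theorem exists_norm_le_of_form_eq (ha : 0 < a) (hc : ∀ x ∈ Icc (0 : ℝ) 1, a ≤ c x)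
    (hs : IntervalIntegrable (slowness c) volume 0 1) (k : ℝ) :
    ∃ C : ℝ, 0 ≤ C ∧ ∀ u p : USpace, (∀ φ, form c k u φ = innerU p φ) → ‖u‖ ≤ C * ‖p‖ := by
  obtain rfl | hk := eq_or_ne k 0
  · refine ⟨1, zero_le_one, fun u p h => ?_⟩
    have : u = p := eq_of_innerU fun φ => by
      rw [← h, form_eq]
      simp
    rw [this, one_mul]
  obtain ⟨A, hA, h⟩ := exists_norm_le_add_norm_apply_one ha hc hs k
  have hc1 : 0 < c 1 := ha.trans_le (hc 1 (right_mem_Icc.2 zero_le_one))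
  set B := c 1 / |k| with hB
  have hB0 : 0 ≤ B := by positivity
  -- From ‖u‖ ≤ A|u(1)| + A‖p‖ and |u(1)|² ≤ B‖p‖‖u‖, Young's inequality absorbs ‖u‖/2 on the left;
  -- doubling gives the constant.
  refine ⟨A ^ 2 * B + 2 * A, by positivity, fun u p hu => ?_⟩
  have h1 : ‖u 1‖ ^ 2 ≤ B * (‖p‖ * ‖u‖) := by
    -- Energy and mass are real on the diagonal, so only the radiation term survives.
    have h2 : (form c k u u).im = -(k / c 1 * ‖u 1‖ ^ 2) := by
      have h3 : Complex.I * (k : ℂ) * (c 1 : ℂ)⁻¹ * u 1 * conj (u 1) =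
          ((k / c 1 * ‖u 1‖ ^ 2 : ℝ) : ℂ) * Complex.I := by
        rw [mul_assoc _ (u 1), Complex.mul_conj, Complex.normSq_eq_norm_sq]
        push_cast
        ring
      rw [form_eq, h3, innerU_self_eq, ← Complex.ofReal_pow]
      simp only [Complex.sub_im, Complex.ofReal_im, Complex.im_ofReal_mul,
        massForm_self_im, Complex.I_im]
      ring
    have h4 : |k / c 1 * ‖u 1‖ ^ 2| ≤ ‖p‖ * ‖u‖ := by
      rw [← abs_neg, ← h2, hu]
      exact (Complex.abs_im_le_norm _).trans (norm_innerU_le p u)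
    rw [abs_mul, abs_div, abs_of_pos hc1, abs_of_nonneg (sq_nonneg ‖u 1‖)] at h4
    have h5 : ‖u 1‖ ^ 2 = B * (|k| / c 1 * ‖u 1‖ ^ 2) := by
      have : |k| ≠ 0 := abs_ne_zero.2 hk
      rw [hB]
      field_simp
    rw [h5]
    gcongr
  have h2 := h u p hu
  have h3 : A * ‖u 1‖ ≤ (‖u‖ + A ^ 2 * B * ‖p‖) / 2 := by
    refine abs_le_of_sq_le_sq' ?_ (by positivity) |>.2
    have h4 : A ^ 2 * ‖u 1‖ ^ 2 ≤ A ^ 2 * (B * (‖p‖ * ‖u‖)) := by gcongr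
    nlinarith [sq_nonneg (‖u‖ - A ^ 2 * B * ‖p‖)]
  nlinarith

end

/-! ### Invertibility and well-posedness -/

/-- The operator of the Helmholtz problem at the (complex) wave number `z`, where `L` and `R`
represent the mass form and the boundary form. -/
noncomputable def helmholtzOperator (c : ℝ → ℝ) (L R : USpace →L[ℂ] USpace) (z : ℂ) :
    USpace →L[ℂ] USpace :=
  1 - z ^ 2 • L - (Complex.I * z * (c 1 : ℂ)⁻¹) • R

theorem innerU_helmholtzOperator {c : ℝ → ℝ} {L R : USpace →L[ℂ] USpace}
    (hL : ∀ u φ, innerU (L u) φ = massForm c u φ)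
    (hR : ∀ u φ, innerU (R u) φ = u 1 * conj (φ 1)) (k : ℝ) (u φ : USpace) :
    innerU (helmholtzOperator c L R k u) φ = form c k u φ := by
  have h : helmholtzOperator c L R k u =
    u - (k : ℂ) ^ 2 • L u - (Complex.I * k * (c 1 : ℂ)⁻¹) • R u := rfl
  rw [h, innerU_sub_left, innerU_sub_left, innerU_smul_left, innerU_smul_left, hL, hR, form_eq]
  ring

theorem hasDerivAt_helmholtzOperator (c : ℝ → ℝ) (L R : USpace →L[ℂ] USpace) (z : ℂ) :
    HasDerivAt (helmholtzOperator c L R)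
      (-((2 * z) • L) - (Complex.I * (c 1 : ℂ)⁻¹) • R) z := by
  have h1 : HasDerivAt (fun z : ℂ => z ^ 2 • L) ((2 * z) • L) z := by
    have := (hasDerivAt_pow 2 z).smul_const L
    simpa using this
  have h2 : HasDerivAt (fun z : ℂ => (Complex.I * z * (c 1 : ℂ)⁻¹) • R)
      ((Complex.I * (c 1 : ℂ)⁻¹) • R) z := by
    have := ((((hasDerivAt_id z).const_mul Complex.I).mul_const (c 1 : ℂ)⁻¹)).smul_const R
    simpa using this
  exact (h1.const_sub 1).sub h2

section

variable {c : ℝ → ℝ} {a : ℝ}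

theorem isUnit_helmholtzOperator (ha : 0 < a) (hc : ∀ x ∈ Icc (0 : ℝ) 1, a ≤ c x)
    (hs : IntervalIntegrable (slowness c) volume 0 1) {L R : USpace →L[ℂ] USpace}
    (hL : ∀ u φ, innerU (L u) φ = massForm c u φ)
    (hR : ∀ u φ, innerU (R u) φ = u 1 * conj (φ 1)) (k : ℝ) :
    IsUnit (helmholtzOperator c L R k) := by
  obtain ⟨C, hC, hbound⟩ := exists_norm_le_of_form_eq ha hc hs k
  set T := helmholtzOperator c L R k with hT
  have hanti : AntilipschitzWith ⟨C, hC⟩ T := T.antilipschitz_of_bound fun u =>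
    hbound u (T u) fun φ => (innerU_helmholtzOperator hL hR k u φ).symm
  rw [ContinuousLinearMap.isUnit_iff_bijective,
    ContinuousLinearMap.bijective_iff_dense_range_and_antilipschitz]
  refine ⟨?_, _, hanti⟩
  rw [Submodule.topologicalClosure_eq_top_iff, Submodule.eq_bot_iff]
  intro v hv
  -- By complex symmetry, a vector orthogonal to the range has a conjugate solving the homogeneous
  -- problem, which stability forces to vanish.
  have h1 : ∀ φ, form c k v.conjU φ = innerU 0 φ := fun φ => by
    have h2 : inner ℂ (T φ.conjU) v = 0 := (Submodule.mem_orthogonal _ _).1 hv _ ⟨_, rfl⟩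
    rw [inner_eq] at h2
    have h3 : innerU (0 : USpace) φ = 0 := inner_zero_right (𝕜 := ℂ) φ
    rw [← conjU_conjU φ, form_conjU, conjU_conjU, ← innerU_helmholtzOperator hL hR, ← hT,
      ← innerU_conj_symm, h2, h3, map_zero]
  have h2 := hbound _ _ h1
  rw [norm_conjU, norm_zero, mul_zero] at h2
  exact norm_le_zero_iff.1 h2

theorem isWellPosed_isWeakSolution (ha : 0 < a) (hc : ∀ x ∈ Icc (0 : ℝ) 1, a ≤ c x)
    (hs : IntervalIntegrable (slowness c) volume 0 1) (k : ℝ) :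
    IsWellPosed (IsWeakSolution c k) := by
  obtain ⟨L, hL⟩ := exists_massOperator ha hc hs
  obtain ⟨R, hR⟩ := exists_boundaryOperator
  obtain ⟨C, hC, hbound⟩ := exists_norm_le_of_form_eq ha hc hs k
  have hbij := ContinuousLinearMap.isUnit_iff_bijective.1
    (isUnit_helmholtzOperator ha hc hs hL hR k)
  refine ⟨fun P => ?_, C, fun P u hu => ?_⟩
  · obtain ⟨p, hp, -⟩ := exists_riesz P
    obtain ⟨u, hu⟩ := hbij.2 p
    refine ⟨u, fun φ => ?_, fun v hv => hbij.1 (eq_of_innerU fun φ => ?_)⟩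
    · rw [← innerU_helmholtzOperator hL hR, hu, hp]
    · rw [innerU_helmholtzOperator hL hR, hv φ, hu, hp]
  · obtain ⟨p, hp, hpn⟩ := exists_riesz P
    refine (hbound u p fun φ => ?_).trans (by gcongr)
    rw [hu φ, hp]

/-! ### Adjoint problem and reciprocity -/

/-- The source that represents the complex conjugate distribution. -/
noncomputable def conjSource (P : Dual) : Dual :=
  LinearMap.mkContinuous
    { toFun := fun φ => conj (P φ.conjU)
      map_add' := fun u v => by rw [conjU_add, map_add, map_add]
      map_smul' := fun r u => by
        rw [conjU_smul, map_smulₛₗ, smul_eq_mul, map_mul, Complex.conj_conj, smul_eq_mul] }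
    ‖P‖ fun u => by
      change ‖conj (P u.conjU)‖ ≤ _
      rw [RCLike.norm_conj, ← norm_conjU u]
      exact P.le_opNorm _

theorem conjSource_apply (P : Dual) (φ : USpace) : conjSource P φ = conj (P φ.conjU) := rfl

theorem norm_conjSource_le (P : Dual) : ‖conjSource P‖ ≤ ‖P‖ :=
  LinearMap.mkContinuous_norm_le _ (norm_nonneg P) _

theorem isAdjointWeakSolution_iff (c : ℝ → ℝ) (k : ℝ) (P : Dual) (w : USpace) :
    IsAdjointWeakSolution c k P w ↔ IsWeakSolution c k (conjSource P) w.conjU := by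
  constructor
  · intro h φ
    rw [conjSource_apply, ← h, Complex.conj_conj, ← form_conjU, conjU_conjU]
  · intro h φ
    have := h φ.conjU
    rw [conjSource_apply, conjU_conjU, form_conjU] at this
    rw [this, Complex.conj_conj]

theorem isWellPosed_isAdjointWeakSolution {k : ℝ} (h : IsWellPosed (IsWeakSolution c k)) :
    IsWellPosed (IsAdjointWeakSolution c k) := by
  obtain ⟨h1, C, h2⟩ := h
  -- `IsWellPosed` does not assert C ≥ 0, which is needed to replace the norm of `conjSource P` by
  -- that of P.
  refine ⟨fun P => ?_, |C|, fun P w hw => ?_⟩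
  · obtain ⟨u, hu, huniq⟩ := h1 (conjSource P)
    refine ⟨u.conjU, ?_, fun w hw => ?_⟩
    · beta_reduce
      rw [isAdjointWeakSolution_iff, conjU_conjU]
      exact hu
    · rw [← huniq _ ((isAdjointWeakSolution_iff c k P w).1 hw), conjU_conjU]
  · have := h2 _ _ ((isAdjointWeakSolution_iff c k P w).1 hw)
    rw [norm_conjU] at this
    refine this.trans (mul_le_mul (le_abs_self C) (norm_conjSource_le P)
      (norm_nonneg (conjSource P)) (abs_nonneg C))

theorem IsRealSource.conjSource_eq {P : Dual} (hP : IsRealSource P) : conjSource P = P := by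
  ext φ
  rw [conjSource_apply, hP, Complex.conj_conj]

/-- Reality of the sources writes both sides as conjugates of the symmetric bilinear form evaluated
at u and v. -/
theorem IsRealSource.apply_symm {P Q : Dual} (hP : IsRealSource P) (hQ : IsRealSource Q) {k : ℝ}
    {u v : USpace} (hu : IsWeakSolution c k P u) (hv : IsWeakSolution c k Q v) : P v = Q u := by
  have h1 : P v = conj (form c k u v.conjU) := by rw [hu, hP, Complex.conj_conj]
  have h2 : Q u = conj (form c k v u.conjU) := by rw [hv, hQ, Complex.conj_conj]
  rw [h1, h2, form_conjU_right]

/-! ### Differentiation in the wave number and the Gram identity -/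

/-- Solutions depend differentiably on the wave number, and the derivative solves the
differentiated problem. -/
theorem exists_hasDerivAt_solution (ha : 0 < a) (hc : ∀ x ∈ Icc (0 : ℝ) 1, a ≤ c x)
    (hs : IntervalIntegrable (slowness c) volume 0 1) {P : Dual} {u : ℝ → USpace}
    (hu : ∀ k, IsWeakSolution c k P (u k)) (k : ℝ) :
    ∃ u' : USpace,
      (∀ f : USpace →L[ℂ] ℂ, HasDerivAt (fun t => f (u t)) (f u') k) ∧
      ∀ φ, form c k u' φ =
        2 * (k : ℂ) * massForm c (u k) φ + Complex.I * (c 1 : ℂ)⁻¹ * (u k 1 * conj (φ 1)) := by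
  obtain ⟨L, hL⟩ := exists_massOperator ha hc hs
  obtain ⟨R, hR⟩ := exists_boundaryOperator
  obtain ⟨p, hp, -⟩ := exists_riesz P
  have hunit := fun t => isUnit_helmholtzOperator ha hc hs hL hR t
  have hTu : ∀ t : ℝ, helmholtzOperator c L R t (u t) = p := fun t => eq_of_innerU fun φ => by
    rw [innerU_helmholtzOperator hL hR, hu t φ, hp]
  have hinv : ∀ t : ℝ, u t = Ring.inverse (helmholtzOperator c L R t) p := fun t => by
    have h1 := Ring.inverse_mul_cancel _ (hunit t)
    have h2 := congrArg (fun S : USpace →L[ℂ] USpace => S (u t)) h1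
    simp only [mul_apply_eq_comp, hTu, one_apply_eq_self] at h2
    exact h2.symm
  set T' := -((2 * (k : ℂ)) • L) - (Complex.I * (c 1 : ℂ)⁻¹) • R with hT'
  have hT : HasDerivAt (helmholtzOperator c L R) T' (k : ℂ) :=
    hasDerivAt_helmholtzOperator c L R k
  set V : ℂ → USpace := fun z => Ring.inverse (helmholtzOperator c L R z) p with hV
  obtain ⟨e, he⟩ := hunit k
  have hVd : DifferentiableAt ℂ V (k : ℂ) :=
    (hT.differentiableAt.inverse (hunit k)).clm_apply (differentiableAt_const p)
  set u' := deriv V (k : ℂ) with hu'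
  have hprod := hT.clm_apply hVd.hasDerivAt
  have hopen : ∀ᶠ z in nhds (k : ℂ), IsUnit (helmholtzOperator c L R z) :=
    hT.continuousAt.eventually (Units.isOpen.mem_nhds (hunit k))
  -- Invertibility is an open condition, so T(z)V(z) = p persists near k in ℂ and can be
  -- differentiated by the product rule.
  have hconst : (fun z => helmholtzOperator c L R z (V z)) =ᶠ[nhds (k : ℂ)] fun _ => p := by
    filter_upwards [hopen] with z hz
    have h1 := Ring.mul_inverse_cancel _ hz
    exact congrArg (fun S : USpace →L[ℂ] USpace => S p) h1
  have hzero : T' (V k) + helmholtzOperator c L R k u' = 0 :=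
    hprod.unique ((hasDerivAt_const (k : ℂ) p).congr_of_eventuallyEq hconst)
  refine ⟨u', fun f => ?_, fun φ => ?_⟩
  · have h1 : HasDerivAt (fun z => f (V z)) (f u') (k : ℂ) :=
      f.hasFDerivAt.comp_hasDerivAt (k : ℂ) hVd.hasDerivAt
    simpa only [hinv] using h1.comp_ofReal
  · have h1 : helmholtzOperator c L R k u' =
        (2 * (k : ℂ)) • L (u k) + (Complex.I * (c 1 : ℂ)⁻¹) • R (u k) := by
      rw [eq_neg_of_add_eq_zero_right hzero, hinv k, hT']
      simp only [_root_.sub_apply, _root_.neg_apply,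
        _root_.smul_apply]
      abel
    rw [← innerU_helmholtzOperator hL hR, h1, innerU_add_left, innerU_smul_left,
      innerU_smul_left, hL, hR]

/-- Evaluation at a point, as a continuous linear functional. -/
noncomputable def evalCLM (x : unitInterval) : USpace →L[ℂ] ℂ :=
  LinearMap.mkContinuous
    { toFun := fun u => u x
      map_add' := fun _ _ => rfl
      map_smul' := fun _ _ => rfl } 1 fun u => by
    rw [one_mul]
    exact u.norm_apply_le x

/-- The Gram matrix entry of two solutions in terms of the data and their derivatives. -/
theorem innerU_eq_of_solutions {k : ℝ} {P Q : Dual} {u v u' v' : USpace}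
    (hu : IsWeakSolution c k P u) (hv : IsWeakSolution c k Q v) (hPv : P v = Q u)
    (hPv' : P v' = Q u')
    (hu' : ∀ φ, form c k u' φ =
      2 * (k : ℂ) * massForm c u φ + Complex.I * (c 1 : ℂ)⁻¹ * (u 1 * conj (φ 1)))
    (hv' : ∀ φ, form c k v' φ =
      2 * (k : ℂ) * massForm c v φ + Complex.I * (c 1 : ℂ)⁻¹ * (v 1 * conj (φ 1))) :
    innerU v u = ((P v + (k : ℂ) / 2 * P v').re : ℂ) +
      Complex.I * (k : ℂ) ^ 2 / (2 * (c 1 : ℂ)) *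
        (conj (u' 1) * v 1 - conj (u 1) * v' 1) := by
  have e1 : innerU v u = Q u + (k : ℂ) ^ 2 * massForm c v u
      + Complex.I * (k : ℂ) * (c 1 : ℂ)⁻¹ * v 1 * conj (u 1) := by
    rw [← hv u, form_eq]; ring
  have e2 := hv' u
  have e3 := form_conj_symm c k u v'
  rw [hu v'] at e3
  have f1 : innerU u v = P v + (k : ℂ) ^ 2 * massForm c u v
      + Complex.I * (k : ℂ) * (c 1 : ℂ)⁻¹ * u 1 * conj (v 1) := by
    rw [← hu v, form_eq]; ring
  have f2 := hu' v
  have f3 := form_conj_symm c k v u'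
  rw [hv u', ← hPv'] at f3
  have g := congrArg conj f1
  rw [innerU_conj_symm] at g
  have g2 := congrArg conj f2
  have g3 := congrArg conj f3
  simp only [map_add, map_mul, map_inv₀, map_pow, Complex.conj_ofReal, Complex.conj_conj,
    Complex.conj_I, massForm_conj_symm, map_ofNat] at g g2 g3
  have hre : ((P v + (k : ℂ) / 2 * P v').re : ℂ) =
      (P v + (k : ℂ) / 2 * P v' + (conj (P v) + (k : ℂ) / 2 * conj (P v'))) / 2 := by
    rw [Complex.re_eq_add_conj]
    simp only [map_add, map_mul, map_div₀, Complex.conj_ofReal, map_ofNat]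
  rw [hre]
  have hdiv : Complex.I * (k : ℂ) ^ 2 / (2 * (c 1 : ℂ)) =
      Complex.I * (k : ℂ) ^ 2 * (c 1 : ℂ)⁻¹ / 2 := by
    rw [div_eq_mul_inv, mul_inv]; ring
  rw [hdiv]
  rw [← hPv] at e1
  -- The tested derivative equations `e2`, `e3` and their conjugate counterparts `g2`, `g3` remove
  -- k² times the mass form from the average of `e1` and `g`.
  linear_combination (e1 + g) / 2 - (k : ℂ) / 4 * (e2 + g2) - (k : ℂ) / 4 * (e3 + g3)

end

theorem innerU_conjU (u v : USpace) : innerU u.conjU v.conjU = innerU v u := by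
  simp only [innerU, derivative_conjU, Complex.conj_conj]
  simp only [mul_comm]

/-- P is antilinear, hence the conjugate of a bounded linear functional; conjugation commutes with
differentiation in a real variable. -/
theorem hasDerivAt_source_apply (P : Dual) {u : ℝ → USpace} {u' : USpace} {k : ℝ}
    (h : ∀ f : USpace →L[ℂ] ℂ, HasDerivAt (fun t => f (u t)) (f u') k) :
    HasDerivAt (fun t => P (u t)) (P u') k := by
  obtain ⟨p, hp, -⟩ := exists_riesz P
  have h1 : ∀ v, P v = star (innerSL ℂ p v) := fun v => by
    rw [← hp, ← innerU_conj_symm]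
    rfl
  simp only [h1]
  exact (h (innerSL ℂ p)).star

end Helmholtz

theorem mainTheorem7 (c : ℝ → ℝ) (a b : ℝ) (ha : 0 < a)
    (hcm : AEMeasurable c (volume.restrict (Icc (0 : ℝ) 1)))
    (hc : ∀ x ∈ Icc (0 : ℝ) 1, a ≤ c x ∧ c x ≤ b) :
    (∀ k : ℝ, Helmholtz.IsWellPosed (Helmholtz.IsWeakSolution c k) ∧
      Helmholtz.IsWellPosed (Helmholtz.IsAdjointWeakSolution c k)) ∧
    ∀ (n : ℕ) (P : Fin n → Helmholtz.Dual), (∀ i, Helmholtz.IsRealSource (P i)) →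
    ∀ u w : Fin n → ℝ → Helmholtz.USpace,
      (∀ i k, Helmholtz.IsWeakSolution c k (P i) (u i k)) →
      (∀ i k, Helmholtz.IsAdjointWeakSolution c k (P i) (w i k)) →
    ∀ (d g : Fin n → Fin n → ℝ → ℂ) (β : Fin n → ℝ → ℂ),
      (∀ i j k, d i j k = P i (u j k)) →
      (∀ i j k, g i j k = Helmholtz.innerU (w i k) (w j k)) →
      (∀ i k, β i k = u i k 1) →
    ∀ k : ℝ,
      (∀ i x, w i k x = conj (u i k x)) ∧
      (∀ i j, d i j k = d j i k) ∧
      (∀ i j, DifferentiableAt ℝ (d i j) k) ∧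
      (∀ i, DifferentiableAt ℝ (β i) k) ∧
      ∀ i j, g i j k =
        ((d i j k + (k : ℂ) / 2 * deriv (d i j) k).re : ℂ) +
          Complex.I * (k : ℂ) ^ 2 / (2 * (c 1 : ℂ)) *
            (conj (deriv (β i) k) * β j k - conj (β i k) * deriv (β j) k) := by
  have hc1 : ∀ x ∈ Icc (0 : ℝ) 1, a ≤ c x := fun x hx => (hc x hx).1
  have hs := Helmholtz.intervalIntegrable_slowness ha hc1 hcm
  have hwp := Helmholtz.isWellPosed_isWeakSolution ha hc1 hs
  refine ⟨fun k => ⟨hwp k, Helmholtz.isWellPosed_isAdjointWeakSolution (hwp k)⟩, ?_⟩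
  intro n P hP u w hu hw d g β hd hg hβ k
  have hwu : ∀ i, w i k = (u i k).conjU := fun i => by
    have h1 := (Helmholtz.isAdjointWeakSolution_iff c k (P i) (w i k)).1 (hw i k)
    rw [(hP i).conjSource_eq] at h1
    rw [((hwp k).1 (P i)).unique (hu i k) h1, Helmholtz.USpace.conjU_conjU]
  have hsymm : ∀ i j t, d i j t = d j i t := fun i j t => by
    rw [hd, hd, (hP i).apply_symm (hP j) (hu i t) (hu j t)]
  choose u' hu' hform using fun i => Helmholtz.exists_hasDerivAt_solution ha hc1 hs (hu i) k
  have hdd : ∀ i j, HasDerivAt (d i j) (P i (u' j)) k := fun i j => by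
    rw [show d i j = fun t => P i (u j t) from funext (hd i j)]
    exact Helmholtz.hasDerivAt_source_apply (P i) (hu' j)
  have hβd : ∀ i, HasDerivAt (β i) (u' i 1) k := fun i => by
    rw [show β i = fun t => u i t 1 from funext (hβ i)]
    exact hu' i (Helmholtz.evalCLM 1)
  refine ⟨fun i x => by rw [hwu, Helmholtz.USpace.conjU_apply], fun i j => hsymm i j k,
    fun i j => (hdd i j).differentiableAt, fun i => (hβd i).differentiableAt, fun i j => ?_⟩
  -- Reciprocity differentiated in k.
  have hderiv : P i (u' j) = P j (u' i) :=
    (hdd i j).unique (by rw [show d i j = d j i from funext (hsymm i j)]; exact hdd j i)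
  rw [hg, hwu, hwu, Helmholtz.innerU_conjU, (hdd i j).deriv, (hβd i).deriv, (hβd j).deriv, hd, hβ,
    hβ]
  exact Helmholtz.innerU_eq_of_solutions (hu i k) (hu j k)
    ((hP i).apply_symm (hP j) (hu i k) (hu j k)) hderiv (hform i) (hform j)
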